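/- Let $p$ be an odd prime, and let $G_1$ and $G_2$ be nontrivial groups (finite or infinite) of exponent $p$ that are nilpotent of class at most two. Let $F = G_1 * G_2$ be their free product, with lower central series $F_1 = F$, $F_{n+1} = [F_n, F]$, and let $G = G_1 \amalg^{\mathfrak{N}_2} G_2 = F/F_3$ be the 2-nilpotent product of $G_1$ and $G_2$, that is, their coproduct in the variety $\mathfrak{N}_2$ of nilpotent groups of class at most two. Then $G$ is capable: there is a group $H$ such that $G \cong H/Z(H)$, where $Z(H)$ is the center of $H$. -/

import Mathlib

universe u v

/-- A group `G` is capable if it is isomorphic to `H / Z(H)` for some group `H`. -/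
def IsCapable (G : Type u) [Group G] : Prop :=
  ∃ (H : Type u) (_ : Group H), Nonempty (G ≃* H ⧸ Subgroup.center H)

/-- `G` is nilpotent of class at most `k`: the `(k+1)`-st term of the lower central series
is trivial. (Mathlib numbers the terms from `0`, so this is the term with index `k`.) -/
def IsNilpotentOfClassLE (k : ℕ) (G : Type u) [Group G] : Prop :=
  (⊤ : Subgroup G).lowerCentralSeries k = ⊥

/-- The `k`-nilpotent product of two groups: the quotient of their free product `F` by the
`(k+1)`-st term `F_{k+1}` of its lower central series (`F_1 = F`). For factors of class at
most `k` it is their coproduct in the variety of nilpotent groups of class at most `k`. -/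
abbrev NilpotentProduct (k : ℕ) (A : Type u) (B : Type v) [Group A] [Group B] : Type (max u v) :=
  Monoid.Coprod A B ⧸ (⊤ : Subgroup (Monoid.Coprod A B)).lowerCentralSeries k

/-!
Write `F = G₁ * G₂` and index the lower central series from `0`, so that `G = F / γ₂`. It suffices
that every `x : F` commuting with all of `F` modulo `γ₃` lies in `γ₂`: then `G` is the quotient of
`F / γ₃` by its center.

In any representation of `F`, the elements of `γ₃` fix every vector killed by all products of four
differences `g - 1`. The crossed homomorphism `F → (G₁ → M)` that vanishes on `G₁` and sends
`b : G₂` to `φ b` is the orbit map of such a vector whenever the functions `φ b` are polynomial of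
degree at most two, and then it agrees at `x * y` and `y * x` if `⁅x, y⁆ ∈ γ₃`. Two choices of `φ`
pin down an `x` that commutes with all of `F` modulo `γ₃`:

* For an odd exponent, Baer's addition makes a group of class two an elementary abelian group
  whose linear functionals are quadratic for the original multiplication, so quadratic functions
  separate the points of `G₁` and the projection of `x` to `G₁` is trivial. By symmetry so is its
  projection to `G₂`.
* For a linear functional `f` on the abelianization of `G₁`, polarizing `f ^ 2` gives
  `2 * f a * f a'`. As `2` is invertible, this kills the coordinate of `x` in the tensor product of
  the abelianizations.

Modulo `γ₂`, an element of `F` is determined by its two projections and its tensor coordinate.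
-/

open scoped commutatorElement IsMulCommutative TensorProduct

section Unipotent

variable {k Γ V : Type*} [Ring k] [Group Γ] [AddCommGroup V] [Module k V]
  {ρ : Representation k Γ V}

/-- The elements `g` for which `ρ g - 1` lowers the degree of the filtration `Z` by at least `n`. -/
def filtrationStabilizer (Z : ℕ → Subrepresentation ρ) (n : ℕ) : Subgroup Γ where
  carrier := {g | ∀ d, ∀ v ∈ Z (d + n), ρ g v - v ∈ Z d}
  one_mem' d v _ := by
    rw [map_one, Module.End.one_apply, sub_self]
    exact (Z d).toSubmodule.zero_mem
  mul_mem' {a b} ha hb d v hv := by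
    have h : ρ (a * b) v - v = ρ a (ρ b v - v) + (ρ a v - v) := by
      rw [map_mul, Module.End.mul_apply, map_sub, sub_add_sub_cancel]
    rw [h]
    exact (Z d).toSubmodule.add_mem ((Z d).apply_mem_toSubmodule a (hb d v hv)) (ha d v hv)
  inv_mem' {a} ha d v hv := by
    have h : ρ a⁻¹ v - v = -ρ a⁻¹ (ρ a v - v) := by
      rw [map_sub, Representation.inv_self_apply, neg_sub]
    rw [h]
    exact (Z d).toSubmodule.neg_mem ((Z d).apply_mem_toSubmodule a⁻¹ (ha d v hv))

theorem commutator_filtrationStabilizer_le (Z : ℕ → Subrepresentation ρ) (m n : ℕ) :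
    ⁅filtrationStabilizer Z m, filtrationStabilizer Z n⁆ ≤ filtrationStabilizer Z (m + n) := by
  rw [Subgroup.commutator_le]
  intro a ha b hb d v hv
  set w := ρ (b * a)⁻¹ v with hw
  have hw_mem : w ∈ Z (d + (m + n)) := (Z _).apply_mem_toSubmodule _ hv
  have hv_eq : v = ρ (b * a) w := by rw [hw, Representation.self_inv_apply]
  -- `ρ ⁅a, b⁆ - 1 = ((ρ a - 1) (ρ b - 1) - (ρ b - 1) (ρ a - 1)) (ρ (b * a))⁻¹`
  have h : ρ ⁅a, b⁆ v - v =
      (ρ a (ρ b w - w) - (ρ b w - w)) - (ρ b (ρ a w - w) - (ρ a w - w)) := by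
    rw [hv_eq, ← Module.End.mul_apply, ← map_mul,
      show ⁅a, b⁆ * (b * a) = a * b by rw [commutatorElement_def]; group]
    simp only [map_mul, Module.End.mul_apply, map_sub]
    abel
  rw [h]
  refine (Z d).toSubmodule.sub_mem (ha d _ (hb (d + m) w ?_)) (hb d _ (ha (d + n) w ?_))
  · rwa [add_assoc]
  · rwa [add_assoc, add_comm n]

theorem lowerCentralSeries_le_filtrationStabilizer {Z : ℕ → Subrepresentation ρ}
    (hZ : filtrationStabilizer Z 1 = ⊤) (n : ℕ) :
    (⊤ : Subgroup Γ).lowerCentralSeries n ≤ filtrationStabilizer Z (n + 1) := by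
  induction n with
  | zero => exact hZ.ge
  | succ n ih =>
    rw [Subgroup.lowerCentralSeries_succ]
    exact (Subgroup.commutator_mono ih hZ.ge).trans (commutator_filtrationStabilizer_le Z (n + 1) 1)

/-- The vectors fixed modulo `W`: the preimage of the invariants of `V / W`. -/
def unipotentStep (W : Subrepresentation ρ) : Subrepresentation ρ where
  toSubmodule :=
    { carrier := {v | ∀ g, ρ g v - v ∈ W}
      zero_mem' := fun g ↦ by
        rw [map_zero, sub_self]
        exact W.toSubmodule.zero_mem
      add_mem' := fun hv hw g ↦ by
        rw [map_add, add_sub_add_comm]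
        exact W.toSubmodule.add_mem (hv g) (hw g)
      smul_mem' := fun c v hv g ↦ by
        rw [map_smul, ← smul_sub]
        exact W.toSubmodule.smul_mem c (hv g) }
  apply_mem_toSubmodule a v hv g := by
    have h : ρ g (ρ a v) - ρ a v = (ρ (g * a) v - v) - (ρ a v - v) := by
      rw [map_mul, Module.End.mul_apply, sub_sub_sub_cancel_right]
    rw [h]
    exact W.toSubmodule.sub_mem (hv (g * a)) (hv a)

variable (ρ) in
/-- The ascending series of subrepresentations obtained from `⊥` by successively adjoining the
vectors fixed modulo the previous term. The `n`-th term is the largest subrepresentation annihilated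
by all products of `n` operators of the form `ρ g - 1`. -/
def unipotentSeries : ℕ → Subrepresentation ρ
  | 0 => ⊥
  | n + 1 => unipotentStep (unipotentSeries n)

theorem mem_unipotentSeries_zero {v : V} : v ∈ unipotentSeries ρ 0 ↔ v = 0 := Iff.rfl

theorem mem_unipotentSeries_succ {n : ℕ} {v : V} :
    v ∈ unipotentSeries ρ (n + 1) ↔ ∀ g, ρ g v - v ∈ unipotentSeries ρ n := Iff.rfl

theorem apply_eq_of_mem_lowerCentralSeries {n : ℕ} {v : V} (hv : v ∈ unipotentSeries ρ (n + 1))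
    {g : Γ} (hg : g ∈ (⊤ : Subgroup Γ).lowerCentralSeries n) : ρ g v = v := by
  have h_top : filtrationStabilizer (unipotentSeries ρ) 1 = ⊤ :=
    (Subgroup.eq_top_iff' _).2 fun g d v hv ↦ mem_unipotentSeries_succ.1 hv g
  have h := lowerCentralSeries_le_filtrationStabilizer h_top n hg 0 v (by rwa [zero_add])
  exact sub_eq_zero.1 (mem_unipotentSeries_zero.1 h)

theorem apply_mul_comm_of_commutatorElement_mem {n : ℕ} {v : V}
    (hv : v ∈ unipotentSeries ρ (n + 1)) {x y : Γ}
    (hxy : ⁅x, y⁆ ∈ (⊤ : Subgroup Γ).lowerCentralSeries n) : ρ (x * y) v = ρ (y * x) v := by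
  have h : x * y = ⁅x, y⁆ * (y * x) := by rw [commutatorElement_def]; group
  rw [h, map_mul, Module.End.mul_apply]
  exact apply_eq_of_mem_lowerCentralSeries
    ((unipotentSeries ρ (n + 1)).apply_mem_toSubmodule (y * x) hv) hxy

theorem map_mem_unipotentSeries {Γ' V' : Type*} [Group Γ'] [AddCommGroup V'] [Module k V']
    {ρ' : Representation k Γ' V'} (f : Γ' →* Γ) (T : V →ₗ[k] V')
    (hT : ∀ g v, ρ' g (T v) = T (ρ (f g) v)) {n : ℕ} {v : V} (hv : v ∈ unipotentSeries ρ n) :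
    T v ∈ unipotentSeries ρ' n := by
  induction n generalizing v with
  | zero =>
    rw [mem_unipotentSeries_zero] at hv ⊢
    rw [hv, map_zero]
  | succ n ih =>
    refine mem_unipotentSeries_succ.2 fun g ↦ ?_
    rw [hT, ← map_sub]
    exact ih (mem_unipotentSeries_succ.1 hv (f g))

end Unipotent

section RightTranslation

variable (R G M : Type*) [Ring R] [Group G] [AddCommGroup M] [Module R M]

/-- The representation of a group `G` on functions `G → M` by right translation of the argument. -/
def rightTranslation : Representation R G (G → M) where
  toFun a := LinearMap.funLeft R M (· * a)
  map_one' := by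
    ext h y
    simp only [LinearMap.funLeft_apply, mul_one, Module.End.one_apply]
  map_mul' a b := by
    ext h y
    simp only [LinearMap.funLeft_apply, mul_assoc, Module.End.mul_apply]

variable {R G M}

@[simp]
theorem rightTranslation_apply (a : G) (h : G → M) (y : G) :
    rightTranslation R G M a h y = h (y * a) := rfl

theorem const_mem_unipotentSeries (m : M) :
    (fun _ ↦ m) ∈ unipotentSeries (rightTranslation R G M) 1 :=
  mem_unipotentSeries_succ.2 fun _ ↦ mem_unipotentSeries_zero.2 (sub_self _)

theorem affine_mem_unipotentSeries {l : G → M} {m : M} (hl : ∀ x y, l (x * y) = l x + l y) :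
    (fun y ↦ l y + m) ∈ unipotentSeries (rightTranslation R G M) 2 := by
  refine mem_unipotentSeries_succ.2 fun a ↦ ?_
  convert const_mem_unipotentSeries (R := R) (G := G) (l a) using 1
  ext y
  simp only [Pi.sub_apply, rightTranslation_apply, hl]
  abel

theorem quadratic_mem_unipotentSeries {q : G → M} {b : G → G → M}
    (hq : ∀ x y, q (x * y) = q x + q y + b x y) (hb : ∀ x y a, b (x * y) a = b x a + b y a) :
    q ∈ unipotentSeries (rightTranslation R G M) 3 := by
  refine mem_unipotentSeries_succ.2 fun a ↦ ?_
  convert affine_mem_unipotentSeries (R := R) (l := (b · a)) (m := q a) (hb · · a) using 1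
  ext y
  simp only [Pi.sub_apply, rightTranslation_apply, hq]
  abel

theorem comp_mem_unipotentSeries {M' : Type*} [AddCommGroup M'] [Module R M'] (T : M →ₗ[R] M')
    {n : ℕ} {h : G → M} (hh : h ∈ unipotentSeries (rightTranslation R G M) n) :
    T ∘ h ∈ unipotentSeries (rightTranslation R G M') n :=
  map_mem_unipotentSeries (MonoidHom.id G) (T.compLeft G) (fun _ _ ↦ rfl) hh

theorem smul_mem_unipotentSeries {n : ℕ} {q : G → R}
    (hq : q ∈ unipotentSeries (rightTranslation ℤ G R) n) (m : M) :
    (fun y ↦ q y • m) ∈ unipotentSeries (rightTranslation ℤ G M) n :=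
  comp_mem_unipotentSeries ((LinearMap.toSpanSingleton R M m).restrictScalars ℤ) hq

end RightTranslation

section CrossedHom

variable {G K M : Type*} [Group G] [Group K] [AddCommGroup M]

/-- The action of `G * K` on `(G → M) × ℤ` in which `G` translates functions and `b : K` is the
transvection adding the function `y ↦ φ y b`. -/
def coprodRep (φ : G → Additive K →+ M) :
    Representation ℤ (Monoid.Coprod G K) ((G → M) × ℤ) :=
  Monoid.Coprod.lift
    { toFun := fun a ↦ (rightTranslation ℤ G M a).prodMap LinearMap.id
      map_one' := by ext <;> simp
      map_mul' := fun a b ↦ by ext <;> simp [mul_assoc] }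
    { toFun := fun b ↦ LinearMap.id + LinearMap.inl ℤ (G → M) ℤ ∘ₗ
        LinearMap.toSpanSingleton ℤ (G → M) (fun y ↦ φ y (.ofMul b)) ∘ₗ LinearMap.snd ℤ (G → M) ℤ
      map_one' := by ext <;> simp
      map_mul' := fun a b ↦ by ext <;> simp [add_comm] }

/-- The crossed homomorphism from `G * K` to the functions `G → M` that vanishes on `G` and takes
the value `y ↦ φ y b` at `b : K`. It is read off from the orbit of `(0, 1)` under `coprodRep φ`. -/
def crossedHom (φ : G → Additive K →+ M) (x : Monoid.Coprod G K) : G → M :=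
  (coprodRep φ x (0, 1)).1

variable (φ : G → Additive K →+ M)

theorem coprodRep_inl (a : G) (v : (G → M) × ℤ) :
    coprodRep φ (.inl a) v = (rightTranslation ℤ G M a v.1, v.2) := by
  simp [coprodRep]

theorem coprodRep_inr (b : K) (v : (G → M) × ℤ) :
    coprodRep φ (.inr b) v = (v.1 + v.2 • fun y ↦ φ y (.ofMul b), v.2) := by
  ext <;> simp [coprodRep]

@[simp]
theorem crossedHom_inl (a : G) : crossedHom φ (.inl a) = 0 := by
  rw [crossedHom, coprodRep_inl, map_zero]

@[simp]
theorem crossedHom_inr (b : K) : crossedHom φ (.inr b) = fun y ↦ φ y (.ofMul b) := by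
  rw [crossedHom, coprodRep_inr, zero_add, one_smul]

theorem coprodRep_apply (x : Monoid.Coprod G K) (v : (G → M) × ℤ) :
    coprodRep φ x v =
      (rightTranslation ℤ G M (Monoid.Coprod.fst x) v.1 + v.2 • crossedHom φ x, v.2) := by
  induction x using Monoid.Coprod.induction_on generalizing v with
  | inl a => simp [coprodRep_inl]
  | inr b => simp [coprodRep_inr]
  | mul x y hx hy =>
    rw [crossedHom]
    simp [hx, hy, add_assoc]

theorem crossedHom_mul (x y : Monoid.Coprod G K) :
    crossedHom φ (x * y) =
      rightTranslation ℤ G M (Monoid.Coprod.fst x) (crossedHom φ y) + crossedHom φ x := by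
  rw [crossedHom]
  simp [coprodRep_apply]

variable {φ} {n : ℕ}

theorem crossedHom_mem_unipotentSeries
    (hφ : ∀ b, (fun y ↦ φ y b) ∈ unipotentSeries (rightTranslation ℤ G M) n)
    (x : Monoid.Coprod G K) : crossedHom φ x ∈ unipotentSeries (rightTranslation ℤ G M) n := by
  induction x using Monoid.Coprod.induction_on with
  | inl a =>
    rw [crossedHom_inl]
    exact (unipotentSeries _ n).toSubmodule.zero_mem
  | inr b =>
    rw [crossedHom_inr]
    exact hφ (.ofMul b)
  | mul x y hx hy =>
    rw [crossedHom_mul]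
    exact (unipotentSeries _ n).toSubmodule.add_mem
      ((unipotentSeries _ n).apply_mem_toSubmodule _ hy) hx

theorem zero_one_mem_unipotentSeries
    (hφ : ∀ b, (fun y ↦ φ y b) ∈ unipotentSeries (rightTranslation ℤ G M) n) :
    ((0, 1) : (G → M) × ℤ) ∈ unipotentSeries (coprodRep φ) (n + 1) := by
  refine mem_unipotentSeries_succ.2 fun x ↦ ?_
  have h : coprodRep φ x (0, 1) - (0, 1) = LinearMap.inl ℤ (G → M) ℤ (crossedHom φ x) := by
    simp [coprodRep_apply]
  rw [h]
  exact map_mem_unipotentSeries Monoid.Coprod.fst (LinearMap.inl ℤ (G → M) ℤ)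
    (fun g v ↦ by simp [coprodRep_apply]) (crossedHom_mem_unipotentSeries hφ x)

theorem crossedHom_mul_comm
    (hφ : ∀ b, (fun y ↦ φ y b) ∈ unipotentSeries (rightTranslation ℤ G M) n)
    {x y : Monoid.Coprod G K}
    (hxy : ⁅x, y⁆ ∈ (⊤ : Subgroup (Monoid.Coprod G K)).lowerCentralSeries n) :
    crossedHom φ (x * y) = crossedHom φ (y * x) :=
  congrArg Prod.fst (apply_mul_comm_of_commutatorElement_mem (zero_one_mem_unipotentSeries hφ) hxy)

end CrossedHom

section TensorCoordinate

variable {R G K V W : Type*} [CommRing R] [Group G] [Group K]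
  [AddCommGroup V] [AddCommGroup W] [Module R V] [Module R W]

/-- The tensor coordinate of an element of `G * K`: the function that vanishes on `G` and `K` and
satisfies `t (x * y) = t x + t y + α x ⊗ β y`. With `α` and `β` the abelianization maps over `ℤ`, it
identifies the kernel of `G * K → G × K`, modulo triple commutators, with the tensor product. -/
def tensorCoordinate (α : Additive G →+ V) (β : Additive K →+ W) (x : Monoid.Coprod G K) :
    V ⊗[R] W :=
  crossedHom
    (fun y ↦ (TensorProduct.mk R V W (α (.ofMul y))).toAddMonoidHom.comp β) x 1

variable (α : Additive G →+ V) (β : Additive K →+ W)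

theorem tensorCoordinate_inl (a : G) : tensorCoordinate (R := R) α β (.inl a) = 0 := by
  simp [tensorCoordinate]

theorem tensorCoordinate_inr (b : K) : tensorCoordinate (R := R) α β (.inr b) = 0 := by
  simp [tensorCoordinate]

theorem crossedHom_tmul_apply (x : Monoid.Coprod G K) (y : G) :
    crossedHom (fun y ↦ (TensorProduct.mk R V W (α (.ofMul y))).toAddMonoidHom.comp β) x y =
      tensorCoordinate (R := R) α β x + α (.ofMul y) ⊗ₜ β (.ofMul (Monoid.Coprod.snd x)) := by
  rw [tensorCoordinate]
  induction x using Monoid.Coprod.induction_on generalizing y with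
  | inl a => simp
  | inr b => simp
  | mul x x' hx hx' =>
    simp only [crossedHom_mul, Pi.add_apply, rightTranslation_apply, one_mul, map_mul, ofMul_mul,
      map_add]
    rw [hx, hx', hx' (Monoid.Coprod.fst x), ofMul_mul, map_add, TensorProduct.add_tmul,
      TensorProduct.tmul_add]
    abel

theorem tensorCoordinate_mul (x y : Monoid.Coprod G K) :
    tensorCoordinate (R := R) α β (x * y) =
      tensorCoordinate α β x + tensorCoordinate α β y +
        α (.ofMul (Monoid.Coprod.fst x)) ⊗ₜ β (.ofMul (Monoid.Coprod.snd y)) := by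
  rw [tensorCoordinate, crossedHom_mul, Pi.add_apply, rightTranslation_apply, one_mul,
    crossedHom_tmul_apply, ← tensorCoordinate]
  abel

theorem crossedHom_sq_smul_apply (f : Module.Dual R V) (x : Monoid.Coprod G K) (y : G) :
    crossedHom (fun y ↦ f (α (.ofMul y)) ^ 2 • β) x y =
      crossedHom (fun y ↦ f (α (.ofMul y)) ^ 2 • β) x 1 +
        f (α (.ofMul y)) ^ 2 • β (.ofMul (Monoid.Coprod.snd x)) +
        (2 * f (α (.ofMul y))) • TensorProduct.lid R W (f.rTensor W (tensorCoordinate α β x)) := by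
  induction x using Monoid.Coprod.induction_on generalizing y with
  | inl a => simp [tensorCoordinate_inl]
  | inr b => simp [tensorCoordinate_inr]
  | mul x x' hx hx' =>
    simp only [crossedHom_mul, Pi.add_apply, rightTranslation_apply, one_mul, map_mul, ofMul_mul,
      map_add, tensorCoordinate_mul, LinearMap.rTensor_tmul, TensorProduct.lid_tmul]
    rw [hx, hx', hx' (Monoid.Coprod.fst x), ofMul_mul, map_add, map_add]
    module

end TensorCoordinate

section Detection

variable {k G K W : Type*} [Field k] [Group G] [Group K] [AddCommGroup W] [Module k W]
  {β : Additive K →+ W} {x : Monoid.Coprod G K}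

theorem apply_fst_eq_zero_of_commutatorElement_inr_mem {n : ℕ} {q : G → k}
    (hq : q ∈ unipotentSeries (rightTranslation ℤ G k) n) (hq_one : q 1 = 0) {b : K}
    (hb : β (.ofMul b) ≠ 0)
    (hx : ⁅x, .inr b⁆ ∈ (⊤ : Subgroup (Monoid.Coprod G K)).lowerCentralSeries n) :
    q (Monoid.Coprod.fst x) = 0 := by
  have h := congrFun (crossedHom_mul_comm (φ := fun y ↦ q y • β)
    (fun b ↦ smul_mem_unipotentSeries hq (β b)) hx) 1
  have h_smul : q (Monoid.Coprod.fst x) • β (.ofMul b) = 0 := by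
    simpa [crossedHom_mul, hq_one] using h
  exact (smul_eq_zero.1 h_smul).resolve_right hb

theorem tensorCoordinate_eq_zero_of_commutatorElement_inl_mem {V : Type*} [AddCommGroup V]
    [Module k V] {α : Additive G →+ V} (hα : Function.Surjective α) (h_two : (2 : k) ≠ 0)
    (h_snd : Monoid.Coprod.snd x = 1)
    (hx : ∀ a, ⁅x, .inl a⁆ ∈ (⊤ : Subgroup (Monoid.Coprod G K)).lowerCentralSeries 3) :
    tensorCoordinate (R := k) α β x = 0 := by
  have h_zero (f : Module.Dual k V) :
      TensorProduct.lid k W (f.rTensor W (tensorCoordinate α β x)) = 0 := by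
    by_cases hf : f = 0
    · simp [hf]
    obtain ⟨v, hv⟩ := DFunLike.ne_iff.1 hf
    obtain ⟨a, rfl⟩ := hα v
    have h_sq : (fun y ↦ f (α (.ofMul y)) ^ 2) ∈ unipotentSeries (rightTranslation ℤ G k) 3 :=
      quadratic_mem_unipotentSeries (b := fun y z ↦ 2 * f (α (.ofMul y)) * f (α (.ofMul z)))
        (fun y z ↦ by simp only [ofMul_mul, map_add]; ring)
        (fun y z a ↦ by simp only [ofMul_mul, map_add]; ring)
    have h := congrFun (crossedHom_mul_comm (φ := fun y ↦ f (α (.ofMul y)) ^ 2 • β)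
      (fun b ↦ smul_mem_unipotentSeries h_sq (β b)) (hx a.toMul)) 1
    have h_smul : (2 * f (α a)) • TensorProduct.lid k W
        (f.rTensor W (tensorCoordinate α β x)) = 0 := by
      simpa [crossedHom_mul, crossedHom_sq_smul_apply _ _ _ x a.toMul, h_snd] using h
    exact (smul_eq_zero.1 h_smul).resolve_left (mul_ne_zero h_two hv)
  classical
  let ℬ := Module.Basis.ofVectorSpace k V
  refine (TensorProduct.equivFinsuppOfBasisLeft (N := W) ℬ).map_eq_zero_iff.1 ?_
  ext i
  rw [TensorProduct.equivFinsuppOfBasisLeft_apply, h_zero, Finsupp.zero_apply]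

end Detection

section ClassTwo

variable {G : Type*} [Group G]

theorem IsNilpotentOfClassLE.commutator_le_center (hc : IsNilpotentOfClassLE 2 G) :
    commutator G ≤ Subgroup.center G := by
  rwa [← Subgroup.commutator_top_right_eq_bot_iff_le_center, ← Subgroup.top_lowerCentralSeries_one,
    ← Subgroup.lowerCentralSeries_succ]

theorem isNilpotentOfClassLE_quotient (k : ℕ) :
    IsNilpotentOfClassLE k (G ⧸ (⊤ : Subgroup G).lowerCentralSeries k) := by
  have h := Subgroup.map_lowerCentralSeries (S := (⊤ : Subgroup G))
    (QuotientGroup.mk' ((⊤ : Subgroup G).lowerCentralSeries k)) k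
  rw [QuotientGroup.map_mk'_self,
    Subgroup.map_top_of_surjective _ (QuotientGroup.mk'_surjective _)] at h
  exact h.symm

theorem IsNilpotentOfClassLE.exists_abelianization_of_ne_one [Nontrivial G] {k : ℕ}
    (hc : IsNilpotentOfClassLE k G) : ∃ g : G, Abelianization.of g ≠ 1 := by
  have : Group.IsNilpotent G :=
    Group.isNilpotent_top.1 (Subgroup.isNilpotent_of_lowerCentralSeries_eq_bot hc)
  obtain ⟨g, -, hg⟩ := SetLike.exists_of_lt (Group.IsSolvable.commutator_lt_top_of_nontrivial G)
  exact ⟨g, fun h ↦ hg (by rwa [← Abelianization.ker_of, MonoidHom.mem_ker])⟩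

/-- The commutator map of a group of class at most two, with values in the center. -/
def commutatorPairing (h : commutator G ≤ Subgroup.center G) : G →* G →* Subgroup.center G :=
  have h_mem (a b : G) : ⁅a, b⁆ ∈ Subgroup.center G :=
    h (Subgroup.commutator_mem_commutator (Subgroup.mem_top a) (Subgroup.mem_top b))
  MonoidHom.mk'
    (fun a ↦ MonoidHom.mk' (fun b ↦ ⟨⁅a, b⁆, h_mem a b⟩) fun b c ↦ by
      ext
      have hc := Subgroup.mem_center_iff.1 (h_mem a c) b
      simp only [Subgroup.coe_mul]
      rw [commutatorElement_mul_right_eq_mul_conj, mul_assoc, mul_assoc, ← mul_assoc b, hc]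
      group)
    fun a b ↦ by
      ext c
      have ha := Subgroup.mem_center_iff.1 (h_mem b c) a
      have hac := Subgroup.mem_center_iff.1 (h_mem b c) ⁅a, c⁆
      simp only [MonoidHom.mk'_apply, MonoidHom.mul_apply, Subgroup.coe_mul]
      rw [commutatorElement_mul_left_eq_conj_mul, ha, hac]
      group

variable (h : commutator G ≤ Subgroup.center G)

@[simp]
theorem coe_commutatorPairing (a b : G) : (commutatorPairing h a b : G) = ⁅a, b⁆ := rfl

theorem inv_commutatorPairing (a b : G) : (commutatorPairing h a b)⁻¹ = commutatorPairing h b a :=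
  Subtype.ext (commutatorElement_inv a b)

@[simp]
theorem commutatorPairing_coe_left (z : Subgroup.center G) (a : G) :
    commutatorPairing h z a = 1 :=
  Subtype.ext (commutatorElement_eq_one_iff_mul_comm.2 (Subgroup.mem_center_iff.1 z.2 a).symm)

@[simp]
theorem commutatorPairing_coe_right (a : G) (z : Subgroup.center G) :
    commutatorPairing h a z = 1 :=
  Subtype.ext (commutatorElement_eq_one_iff_mul_comm.2 (Subgroup.mem_center_iff.1 z.2 a))

/-- The Baer sum `x * y * ⁅y, x⁆ ^ n` on a group of class at most two. It is commutative when `n`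
is inverse to `2` on commutators, and it agrees with the product on commuting elements. -/
def baerAdd (n : ℕ) (x y : G) : G :=
  x * y * ((commutatorPairing h y x ^ n : Subgroup.center G) : G)

theorem baerAdd_of_commute (n : ℕ) {x y : G} (hxy : Commute x y) : baerAdd h n x y = x * y := by
  have h_one : commutatorPairing h y x = 1 :=
    Subtype.ext (commutatorElement_eq_one_iff_mul_comm.2 hxy.eq.symm)
  rw [baerAdd, h_one, one_pow, OneMemClass.coe_one, mul_one]

theorem baerAdd_assoc (n : ℕ) (x y z : G) :
    baerAdd h n (baerAdd h n x y) z = baerAdd h n x (baerAdd h n y z) := by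
  have hz := Subgroup.mem_center_iff.1 (commutatorPairing h y x ^ n).2 z
  simp only [baerAdd, map_mul, commutatorPairing_coe_left, commutatorPairing_coe_right, mul_one,
    MonoidHom.mul_apply, mul_pow]
  rw [mul_assoc _ _ z, ← hz]
  simp only [mul_assoc, ← Subgroup.coe_mul]
  congr 4
  rw [← mul_assoc, mul_comm]

theorem baerAdd_comm {n : ℕ}
    (hn : ∀ x y : G, commutatorPairing h x y ^ (2 * n) = commutatorPairing h x y) (x y : G) :
    baerAdd h n x y = baerAdd h n y x := by
  have h_mul : x * y = y * x * (commutatorPairing h x y : G) := by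
    rw [Subgroup.mem_center_iff.1 (commutatorPairing h x y).2, coe_commutatorPairing,
      commutatorElement_def]
    group
  rw [baerAdd, baerAdd, h_mul, mul_assoc, ← Subgroup.coe_mul]
  congr 2
  rw [← inv_commutatorPairing h x y, inv_pow, mul_inv_eq_iff_eq_mul, ← pow_add, ← two_mul, hn]

/-- The additive group structure of the Baer sum; the multiples of an element are its powers. -/
abbrev baerAddCommGroup (n : ℕ)
    (hn : ∀ x y : G, commutatorPairing h x y ^ (2 * n) = commutatorPairing h x y) :
    AddCommGroup G where
  add := baerAdd h n
  add_assoc := baerAdd_assoc h n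
  zero := (1 : G)
  zero_add x := (baerAdd_of_commute h n (Commute.one_left x)).trans (one_mul x)
  add_zero x := (baerAdd_of_commute h n (Commute.one_right x)).trans (mul_one x)
  nsmul m x := x ^ m
  nsmul_zero := pow_zero
  nsmul_succ m x :=
    (pow_succ x m).trans (baerAdd_of_commute h n ((Commute.refl x).pow_left m)).symm
  neg x := x⁻¹
  zsmul m x := x ^ m
  zsmul_zero' := zpow_zero
  zsmul_succ' m x :=
    (zpow_add_one x m).trans (baerAdd_of_commute h n ((Commute.refl x).zpow_left m)).symm
  zsmul_neg' m x := (zpow_negSucc x m).trans (congrArg _ (zpow_natCast x (m + 1)).symm)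
  neg_add_cancel x :=
    (baerAdd_of_commute h n (Commute.refl x).inv_left).trans (inv_mul_cancel x)
  add_comm := baerAdd_comm h hn

theorem mem_unipotentSeries_three_of_map_baerAdd {M : Type*} [AddCommGroup M] {n : ℕ} {q : G → M}
    (hq : ∀ x y, q (baerAdd h n x y) = q x + q y) :
    q ∈ unipotentSeries (rightTranslation ℤ G M) 3 := by
  have h_central (x : G) (z : Subgroup.center G) : q (x * z) = q x + q z := by
    rw [← hq, baerAdd_of_commute h n (Subgroup.mem_center_iff.1 z.2 x)]
  refine quadratic_mem_unipotentSeries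
    (b := fun x y ↦ q (commutatorPairing h x y ^ n : Subgroup.center G)) (fun x y ↦ ?_)
    fun x y z ↦ by rw [map_mul, MonoidHom.mul_apply, mul_pow, Subgroup.coe_mul, h_central]
  have h_mul : x * y = baerAdd h n x y * (commutatorPairing h x y ^ n : Subgroup.center G) := by
    rw [baerAdd, mul_assoc, ← Subgroup.coe_mul, ← inv_commutatorPairing h x y, inv_pow,
      inv_mul_cancel, OneMemClass.coe_one, mul_one]
  rw [h_mul, h_central, hq]

theorem exists_mem_unipotentSeries_three_apply_ne_zero {p : ℕ} [Fact p.Prime]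
    (h : commutator G ≤ Subgroup.center G) (h_odd : Odd p) (h_exp : ∀ x : G, x ^ p = 1) {g : G}
    (hg : g ≠ 1) :
    ∃ q ∈ unipotentSeries (rightTranslation ℤ G (ZMod p)) 3, q 1 = 0 ∧ q g ≠ 0 := by
  obtain ⟨m, hm⟩ := h_odd
  have hn (x y : G) : commutatorPairing h x y ^ (2 * (m + 1)) = commutatorPairing h x y := by
    rw [show 2 * (m + 1) = p + 1 by lia, pow_succ, ← map_pow, h_exp, map_one, one_mul]
  let := baerAddCommGroup h (m + 1) hn
  have : Module (ZMod p) G := AddCommGroup.zmodModule h_exp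
  obtain ⟨q, hq⟩ := Module.Projective.exists_dual_ne_zero (ZMod p) (show g ≠ 0 from hg)
  exact ⟨q, mem_unipotentSeries_three_of_map_baerAdd h (map_add q), map_zero q, hq⟩

end ClassTwo

section Capability

variable {G : Type*} [Group G]

theorem isCapable_quotient_of_upperCentralSeriesStep_eq {N M : Subgroup G} [N.Normal] [M.Normal]
    (hM : Subgroup.upperCentralSeriesStep N = M) : IsCapable (G ⧸ M) := by
  have h_comap : M = (Subgroup.center (G ⧸ N)).comap (QuotientGroup.mk' N) :=
    hM.symm.trans (Subgroup.upperCentralSeriesStep_eq_comap_center N)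
  have h_le : N ≤ M := h_comap ▸ QuotientGroup.le_comap_mk' N _
  have h_map : M.map (QuotientGroup.mk' N) = Subgroup.center (G ⧸ N) := by
    rw [h_comap, Subgroup.map_comap_eq_self_of_surjective (QuotientGroup.mk'_surjective N)]
  exact ⟨G ⧸ N, inferInstance,
    ⟨(QuotientGroup.quotientQuotientEquivQuotient N M h_le).symm.trans
      (QuotientGroup.quotientMulEquivOfEq h_map)⟩⟩

end Capability

section NormalForm

variable {R G K Q V W : Type*} [CommRing R] [Group G] [Group K] [Group Q]
  [AddCommGroup V] [AddCommGroup W] [Module R V] [Module R W]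

theorem mul_mul_mul_mul_comm_of_commutatorElement_mem_center {s b c : Q}
    (hs : s ∈ Subgroup.center Q) (hbc : ⁅b, c⁆ ∈ Subgroup.center Q) (a d t : Q) :
    a * b * s * (c * d * t) = a * c * (b * d) * (s * t * ⁅b, c⁆) := by
  rw [Subgroup.mem_center_iff] at hs hbc
  have h_swap : b * c = c * b * ⁅b, c⁆ := by
    rw [hbc, commutatorElement_def]
    group
  calc a * b * s * (c * d * t)
    _ = a * (b * c) * d * (s * t) := by rw [mul_assoc (a * b), ← hs, ← hs t]; simp only [mul_assoc]
    _ = a * (c * b) * (⁅b, c⁆ * (d * (s * t))) := by rw [h_swap]; simp only [mul_assoc]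
    _ = a * c * (b * d) * (s * t * ⁅b, c⁆) := by rw [← hbc]; simp only [mul_assoc]

theorem coprod_lift_eq_mul_tensorCoordinate {α : Additive G →+ V} {β : Additive K →+ W}
    {i : G →* Q} {j : K →* Q} {τ : V ⊗[R] W →+ Additive (Subgroup.center Q)}
    (hτ : ∀ a b, ((τ (α (.ofMul a) ⊗ₜ β (.ofMul b))).toMul : Q) = ⁅i a, j b⁆)
    (x : Monoid.Coprod G K) :
    Monoid.Coprod.lift i j x =
      j (Monoid.Coprod.snd x) * i (Monoid.Coprod.fst x) * (τ (tensorCoordinate α β x)).toMul := by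
  induction x using Monoid.Coprod.induction_on with
  | inl a => simp [tensorCoordinate_inl]
  | inr b => simp [tensorCoordinate_inr]
  | mul x y hx hy =>
    have h_mem (a : G) (b : K) : ⁅i a, j b⁆ ∈ Subgroup.center Q := by
      rw [← hτ]
      exact Subtype.coe_prop _
    simp only [map_mul, tensorCoordinate_mul, map_add, toMul_add, Subgroup.coe_mul, hx, hy, hτ]
    exact mul_mul_mul_mul_comm_of_commutatorElement_mem_center (Subtype.coe_prop _) (h_mem _ _)
      _ _ _

theorem exists_tensorProduct_lift {n : ℕ} [NeZero n] {Z : Type*} [CommGroup Z]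
    [Module (ZMod n) (Additive (Abelianization G))] [Module (ZMod n) (Additive (Abelianization K))]
    (β : G →* K →* Z) :
    ∃ τ : Additive (Abelianization G) ⊗[ZMod n] Additive (Abelianization K) →+ Additive Z,
      ∀ a b, τ (.ofMul (.of a) ⊗ₜ .ofMul (.of b)) = .ofMul (β a b) := by
  let β₁ : G →* Abelianization K →* Z := MonoidHom.mk' (fun a ↦ Abelianization.lift (β a)) (by
    intro a a'
    ext b
    simp)
  let β₂ : Additive (Abelianization G) →+ Additive (Abelianization K) →+ Additive Z :=
    AddMonoidHom.mk' (fun x ↦ (Abelianization.lift β₁ x.toMul).toAdditive) (by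
      intro x y
      ext z
      simp)
  refine ⟨TensorProduct.liftAddHom β₂ ?_, fun a b ↦ ?_⟩
  · intro r x y
    rw [← ZMod.natCast_zmod_val r, Nat.cast_smul_eq_nsmul, Nat.cast_smul_eq_nsmul, map_nsmul,
      map_nsmul]
    rfl
  · simp [β₂, β₁]

/-- The `ZMod n`-module structure on the abelianization of a group of exponent dividing `n`. -/
abbrev abelianizationModule {n : ℕ} (h : ∀ g : G, g ^ n = 1) :
    Module (ZMod n) (Additive (Abelianization G)) :=
  AddCommGroup.zmodModule fun x ↦ by
    obtain ⟨g, rfl⟩ := QuotientGroup.mk'_surjective (commutator G) x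
    exact (map_pow Abelianization.of g n).symm.trans (by rw [h, map_one]; rfl)

end NormalForm

section FreeProduct

variable {G K : Type*} [Group G] [Group K] {x : Monoid.Coprod G K}

theorem mem_lowerCentralSeries_two_of_tensorCoordinate_eq_zero {n : ℕ} [NeZero n]
    [Module (ZMod n) (Additive (Abelianization G))] [Module (ZMod n) (Additive (Abelianization K))]
    (h_fst : Monoid.Coprod.fst x = 1) (h_snd : Monoid.Coprod.snd x = 1)
    (h_tensor : tensorCoordinate (R := ZMod n) (Abelianization.of (G := G)).toAdditive
      (Abelianization.of (G := K)).toAdditive x = 0) :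
    x ∈ (⊤ : Subgroup (Monoid.Coprod G K)).lowerCentralSeries 2 := by
  let π := QuotientGroup.mk' ((⊤ : Subgroup (Monoid.Coprod G K)).lowerCentralSeries 2)
  have h_center := (isNilpotentOfClassLE_quotient (G := Monoid.Coprod G K) 2).commutator_le_center
  obtain ⟨τ, hτ⟩ := exists_tensorProduct_lift (n := n)
    (((commutatorPairing h_center).comp (π.comp Monoid.Coprod.inl)).compl₂
      (π.comp Monoid.Coprod.inr))
  have h_normal := coprod_lift_eq_mul_tensorCoordinate
    (i := π.comp Monoid.Coprod.inl) (j := π.comp Monoid.Coprod.inr)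
    (α := (Abelianization.of (G := G)).toAdditive) (β := (Abelianization.of (G := K)).toAdditive)
    (fun a b ↦ congrArg (fun c ↦ c.toMul.1) (hτ a b)) x
  rw [h_fst, h_snd, h_tensor, ← Monoid.Coprod.comp_lift, Monoid.Coprod.lift_inl_inr, map_one,
    map_one, map_zero, toMul_zero, Subgroup.coe_one, mul_one, mul_one] at h_normal
  exact (QuotientGroup.eq_one_iff x).1 h_normal

theorem fst_eq_one_of_commutatorElement_inr_mem {p : ℕ} [Fact p.Prime] (h_odd : Odd p)
    (h : commutator G ≤ Subgroup.center G) (h_exp : ∀ a : G, a ^ p = 1) {W : Type*}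
    [AddCommGroup W] [Module (ZMod p) W] {β : Additive K →+ W} {b : K} (hb : β (.ofMul b) ≠ 0)
    (hx : ⁅x, .inr b⁆ ∈ (⊤ : Subgroup (Monoid.Coprod G K)).lowerCentralSeries 3) :
    Monoid.Coprod.fst x = 1 := by
  by_contra h_fst
  obtain ⟨q, hq, hq_one, hq_fst⟩ :=
    exists_mem_unipotentSeries_three_apply_ne_zero h h_odd h_exp h_fst
  exact hq_fst (apply_fst_eq_zero_of_commutatorElement_inr_mem hq hq_one hb hx)

theorem snd_eq_one_of_commutatorElement_inl_mem {p : ℕ} [Fact p.Prime] (h_odd : Odd p)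
    (h : commutator K ≤ Subgroup.center K) (h_exp : ∀ b : K, b ^ p = 1) {V : Type*}
    [AddCommGroup V] [Module (ZMod p) V] {α : Additive G →+ V} {a : G} (ha : α (.ofMul a) ≠ 0)
    (hx : ⁅x, .inl a⁆ ∈ (⊤ : Subgroup (Monoid.Coprod G K)).lowerCentralSeries 3) :
    Monoid.Coprod.snd x = 1 := by
  have h_swap := Subgroup.lowerCentralSeries_mono 3 le_top <|
    Subgroup.map_lowerCentralSeries ⊤ (Monoid.Coprod.swap G K) 3 ▸ Subgroup.mem_map_of_mem _ hx
  rw [map_commutatorElement, Monoid.Coprod.swap_inl] at h_swap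
  rw [← Monoid.Coprod.fst_swap]
  exact fst_eq_one_of_commutatorElement_inr_mem h_odd h h_exp ha h_swap

variable (G K) in
theorem upperCentralSeriesStep_lowerCentralSeries_three {p : ℕ} [Fact p.Prime] (h_odd : Odd p)
    [Nontrivial G] [Nontrivial K] (hG : IsNilpotentOfClassLE 2 G) (hK : IsNilpotentOfClassLE 2 K)
    (hG_exp : ∀ a : G, a ^ p = 1) (hK_exp : ∀ b : K, b ^ p = 1) :
    Subgroup.upperCentralSeriesStep ((⊤ : Subgroup (Monoid.Coprod G K)).lowerCentralSeries 3) =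
      (⊤ : Subgroup (Monoid.Coprod G K)).lowerCentralSeries 2 := by
  refine le_antisymm (fun x hx ↦ ?_) fun x hx y ↦
    Subgroup.commutator_mem_commutator hx (Subgroup.mem_top y)
  have := abelianizationModule hG_exp
  have := abelianizationModule hK_exp
  obtain ⟨a, ha⟩ := hG.exists_abelianization_of_ne_one
  obtain ⟨b, hb⟩ := hK.exists_abelianization_of_ne_one
  have h_fst : Monoid.Coprod.fst x = 1 :=
    fst_eq_one_of_commutatorElement_inr_mem h_odd hG.commutator_le_center hG_exp
      (β := (Abelianization.of (G := K)).toAdditive) hb (hx _)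
  have h_snd : Monoid.Coprod.snd x = 1 :=
    snd_eq_one_of_commutatorElement_inl_mem h_odd hK.commutator_le_center hK_exp
      (α := (Abelianization.of (G := G)).toAdditive) ha (hx _)
  have h_two : (2 : ZMod p) ≠ 0 := fun h ↦
    ZMod.ne_neg_self h_odd one_ne_zero (eq_neg_of_add_eq_zero_left (one_add_one_eq_two.trans h))
  exact mem_lowerCentralSeries_two_of_tensorCoordinate_eq_zero (n := p) h_fst h_snd
    (tensorCoordinate_eq_zero_of_commutatorElement_inl_mem
      (QuotientGroup.mk'_surjective (commutator G)) h_two h_snd fun a ↦ hx (.inl a))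

end FreeProduct

theorem mainTheorem10 {p : ℕ} (hp : p.Prime) (hodd : Odd p)
    (G₁ : Type u) (G₂ : Type v) [Group G₁] [Group G₂] [Nontrivial G₁] [Nontrivial G₂]
    (hc₁ : IsNilpotentOfClassLE 2 G₁) (hc₂ : IsNilpotentOfClassLE 2 G₂)
    (he₁ : Monoid.exponent G₁ = p) (he₂ : Monoid.exponent G₂ = p) :
    IsCapable (NilpotentProduct 2 G₁ G₂) := by
  have : Fact p.Prime := ⟨hp⟩
  have h_exp₁ (a : G₁) : a ^ p = 1 := he₁ ▸ Monoid.pow_exponent_eq_one a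
  have h_exp₂ (b : G₂) : b ^ p = 1 := he₂ ▸ Monoid.pow_exponent_eq_one b
  exact isCapable_quotient_of_upperCentralSeriesStep_eq
    (upperCentralSeriesStep_lowerCentralSeries_three G₁ G₂ hodd hc₁ hc₂ h_exp₁ h_exp₂)
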